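/- Let $A=\{a,b\}$ and, for an integer $d\ge 0$, let $A_d^*$ be the set of words over $A$ that do not contain $d+1$ consecutive $b$'s, partially ordered by the (not necessarily contiguous) subword order $u\le w$. Let $\zeta$ and $\mu$ be the zeta function and the Möbius function of the poset $A_d^*$. Consider formal series $\sum_{(u,w)\in A^*\times A^*}c_{u,w}\,u\otimes w$ with $c_{u,w}\in\mathbb Z$, added coefficientwise and multiplied by $(u\otimes w)(u'\otimes w')=uu'\otimes ww'$. For a series $f$ without constant term let $f^*=\sum_{n\ge 0}f^n$. A series is rational if it can be obtained from finitely many monomials $c\,u\otimes w$ by finitely many sums, products and applications of $f\mapsto f^*$ to series without constant term. An embedding of $u=u_1\cdots u_k$ in $w=w_1\cdots w_n$ is a set $\iota=\{i_1<\dots<i_k\}$ with $u_j=w_{i_j}$ for all $j$. It is right-most if $i'_j\le i_j$ for every $j$ and every embedding $\{i'_1<\dots<i'_k\}$ of $u$ in $w$. It is $d$-normal if (a) $m\in\iota$ whenever $m\geq 2$ and $w_m=w_{m-1}$; and, if $d\geq 1$, (b) whenever $j>1$ and $u_j=\dots=u_{j+d-1}=b$, one has $w_{i_j-1}=a$ and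 $i_j-1\in\iota$; and (c) if $u$ begins with $b^d$, then none of $w_1,\dots,w_{i_1-1}$ is $b$. A finite-state automaton is a finite digraph (loops and multiple arcs allowed) with an initial vertex $\alpha$ and a final vertex $\omega\ne\alpha$, whose arcs are labelled by monomials $c\,u\otimes w$. The label of a walk is the product of the labels of its arcs. The automaton accepts the series $f$ if, for every $(u,w)$, only finitely many walks from $\alpha$ to $\omega$ have as label a multiple of $u\otimes w$, and their coefficients add up to the coefficient of $u\otimes w$ in $f$. **Theorem.** For every $d\ge 0$, the series $$Z_\otimes^d=\sum_{u,w\in A_d^*}\zeta(u,w)\,u\otimes w\qquad\text{and}\qquad M_\otimes^d=\sum_{u,w\in A_d^*}\mu(u,w)\,u\otimes w$$ are rational. Moreover: 1. there is a finite-state automaton accepting $Z_\otimes^d$ in which every walk from $\alpha$ to $\omega$ is labelled $u\otimes w$ (coefficient $1$) for some $u,w\in A_d^*$, and for all $u,w\in A_d^*$ the walks from $\alpha$ to $\omega$ labelled $u\otimes w$ are in bijection with the right-most embeddings of $u$ in $w$; 2. there is a finite-state automaton accepting $M_\otimes^d$ in which every walk from $\alpha$ to $\omega$ is labelled $(-1)^{|u|+|w|}u\otimes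 w$ for some $u,w\in A_d^*$, and for all $u,w\in A_d^*$ the walks from $\alpha$ to $\omega$ with that label are in bijection with the $d$-normal embeddings of $u$ in $w$. -/

import Mathlib

namespace WordPoset

/-- The alphabet `A = {a, b}`. -/
inductive Letter where
  | a
  | b
  deriving DecidableEq

/-- `A*_d`: the words over `{a, b}` that do not contain `d + 1` consecutive `b`'s. -/
def InAd (d : ℕ) (w : List Letter) : Prop :=
  ¬ List.replicate (d + 1) Letter.b <:+: w

instance (d : ℕ) : DecidablePred (InAd d) := fun w =>
  inferInstanceAs (Decidable (¬ List.replicate (d + 1) Letter.b <:+: w))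

/-- The underlying type of the poset `A*_d`. -/
@[ext]
structure Word (d : ℕ) where
  letters : List Letter
  mem : InAd d letters
  deriving DecidableEq

/-- The subword order. -/
instance (d : ℕ) : PartialOrder (Word d) where
  le u w := u.letters.Sublist w.letters
  le_refl u := List.Sublist.refl _
  le_trans _ _ _ h₁ h₂ := List.Sublist.trans h₁ h₂
  le_antisymm _ _ h₁ h₂ := Word.ext (List.Sublist.antisymm h₁ h₂)

instance (d : ℕ) : DecidableLE (Word d) := fun u w =>
  inferInstanceAs (Decidable (u.letters.Sublist w.letters))

theorem finite_Icc {d : ℕ} (u w : Word d) : (Set.Icc u w).Finite := by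
  refine Set.Finite.of_finite_image (f := Word.letters) ?_ (fun _ _ _ _ h => Word.ext h)
  refine (List.finite_toSet w.letters.sublists).subset ?_
  rintro _ ⟨v, hv, rfl⟩
  exact List.mem_sublists.2 hv.2

noncomputable instance (d : ℕ) : LocallyFiniteOrder (Word d) :=
  LocallyFiniteOrder.ofFiniteIcc finite_Icc

/-! ### Two-variable formal series -/

/-- Formal series `∑ c(u,w) u ⊗ w` with integer coefficients, `(u, w) ∈ A* × A*`. -/
def Series : Type := List Letter → List Letter → ℤ

namespace Series

/-- The monomial `c · u ⊗ w`. -/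
def monomial (c : ℤ) (u w : List Letter) : Series :=
  fun u' w' => if u' = u ∧ w' = w then c else 0

instance : One Series := ⟨monomial 1 [] []⟩

instance : Add Series := ⟨fun f g u w => f u w + g u w⟩

/-- The product determined by `(u ⊗ w)(u' ⊗ w') = uu' ⊗ ww'`: the coefficient at `u ⊗ w` is the sum
over all factorizations of `u` and of `w` into a prefix and a suffix. -/
instance : Mul Series :=
  ⟨fun f g u w => ∑ i ∈ Finset.range (u.length + 1), ∑ j ∈ Finset.range (w.length + 1),
    f (u.take i) (w.take j) * g (u.drop i) (w.drop j)⟩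

/-- The powers of a series. -/
def power (f : Series) : ℕ → Series
  | 0 => 1
  | n + 1 => f * power f n

theorem power_eq_zero (f : Series) (hf : f [] [] = 0) (n : ℕ) (u w : List Letter)
    (h : u.length + w.length < n) : f.power n u w = 0 := by
  induction n generalizing u w with
  | zero => omega
  | succ n ih =>
    change ∑ i ∈ Finset.range (u.length + 1), ∑ j ∈ Finset.range (w.length + 1),
      f (u.take i) (w.take j) * f.power n (u.drop i) (w.drop j) = 0
    refine Finset.sum_eq_zero fun i hi => Finset.sum_eq_zero fun j hj => ?_
    rw [Finset.mem_range] at hi hj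
    by_cases h0 : i = 0 ∧ j = 0
    · rw [h0.1, h0.2, List.take_zero, List.take_zero, hf, zero_mul]
    · rw [ih _ _ (by simp only [List.length_drop]; omega), mul_zero]

/-- `f* = 1 + f + f² + ⋯` for a series without constant term; by `power_eq_zero` only the powers
up to `|u| + |w|` contribute to the coefficient at `u ⊗ w`. -/
def star (f : Series) : Series :=
  fun u w => ∑ n ∈ Finset.range (u.length + w.length + 1), f.power n u w

/-- Rational series: those obtained from monomials by finitely many sums, products and stars (of
series without constant term). Negation and scalar multiplication are products with a monomial
`c · ε ⊗ ε`. -/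
inductive IsRational : Series → Prop
  | monomial (c : ℤ) (u w : List Letter) : IsRational (Series.monomial c u w)
  | add {f g : Series} : IsRational f → IsRational g → IsRational (f + g)
  | mul {f g : Series} : IsRational f → IsRational g → IsRational (f * g)
  | star {f : Series} : IsRational f → f [] [] = 0 → IsRational f.star

end Series

/-- The series `∑ f(u,w) u ⊗ w` over `u, w ∈ A*_d`. -/
def seriesOf (d : ℕ) (f : Word d → Word d → ℤ) : Series :=
  fun u w => if h : InAd d u ∧ InAd d w then f ⟨u, h.1⟩ ⟨w, h.2⟩ else 0

/-- `∑ ζ(u,w) u ⊗ w`, with `ζ` the zeta function of the poset `A*_d`. -/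
def zetaSeries (d : ℕ) : Series :=
  seriesOf d fun u w => IncidenceAlgebra.zeta ℤ u w

/-- `∑ μ(u,w) u ⊗ w`, with `μ` the Möbius function of the poset `A*_d`. -/
noncomputable def muSeries (d : ℕ) : Series :=
  seriesOf d fun u w => IncidenceAlgebra.mu ℤ u w

/-! ### Finite-state automata with `⊗`-labelled arcs -/

/-- A finite digraph (loops and multiple arcs allowed) with an initial and a final vertex, each arc
`e` being labelled by a monomial `coeff e · left e ⊗ right e`. -/
structure Automaton where
  V : Type
  E : Type
  finite_V : Finite V
  finite_E : Finite E
  src : E → V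
  tgt : E → V
  initial : V
  final : V
  initial_ne_final : initial ≠ final
  coeff : E → ℤ
  left : E → List Letter
  right : E → List Letter

namespace Automaton

/-- `D.IsWalk x p y`: the sequence of arcs `p` is a walk from `x` to `y`. -/
def IsWalk (D : Automaton) (x : D.V) : List D.E → D.V → Prop
  | [], y => x = y
  | e :: p, y => D.src e = x ∧ D.IsWalk (D.tgt e) p y

/-- The walks from the initial to the final vertex. -/
def Walk (D : Automaton) : Type := {p : List D.E // D.IsWalk D.initial p D.final}

/-- The label of a walk is the product of the labels of its arcs; this is its coefficient. -/
def walkCoeff (D : Automaton) (W : D.Walk) : ℤ := (W.1.map D.coeff).prod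

/-- The left word in the label of a walk. -/
def walkLeft (D : Automaton) (W : D.Walk) : List Letter := (W.1.map D.left).flatten

/-- The right word in the label of a walk. -/
def walkRight (D : Automaton) (W : D.Walk) : List Letter := (W.1.map D.right).flatten

/-- The walks from the initial to the final vertex labelled by a multiple of `u ⊗ w`. -/
def WalkOn (D : Automaton) (u w : List Letter) : Type :=
  {W : D.Walk // D.walkLeft W = u ∧ D.walkRight W = w}

/-- `D` accepts `f`: the sum of the labels of all walks from the initial to the final vertex is
well defined and equals `f`. -/
def Accepts (D : Automaton) (f : Series) : Prop :=
  ∀ u w : List Letter, Finite (D.WalkOn u w) ∧ ∑ᶠ W : D.WalkOn u w, D.walkCoeff W.1 = f u w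

end Automaton

/-! ### Embeddings -/

/-- An embedding of `u` in `w`: positions `i₁ < ⋯ < i_k` in `w` with `u_j = w_{i_j}`. -/
def Embedding (u w : List Letter) : Type :=
  {i : Fin u.length ↪o Fin w.length // ∀ j, u.get j = w.get (i j)}

/-- The right-most embedding dominates every embedding position by position. -/
def Embedding.IsRightmost {u w : List Letter} (i : Embedding u w) : Prop :=
  ∀ i' : Embedding u w, ∀ j, i'.1 j ≤ i.1 j

/-- `d`-normal embeddings. `repetition`: every position of `w` carrying the same letter as the
preceding position is in the embedding. `inner_run`: if a run of `d` `b`'s starts in `u` at a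
position `j` that is not the first, the letter of `w` just before the image of `j` is an `a` and is
in the embedding. `initial_run`: if `u` starts with a run of `d` `b`'s, no `b` occurs in `w` before
the image of the first letter of `u`. A run is nonempty, so for `d = 0` the last two are void. -/
structure Embedding.IsNormal (d : ℕ) {u w : List Letter} (i : Embedding u w) : Prop where
  repetition : ∀ p q : Fin w.length, q.val = p.val + 1 → w.get q = w.get p → q ∈ Set.range i.1
  inner_run : 0 < d → ∀ j : Fin u.length, 0 < j.val →
    List.replicate d Letter.b <+: u.drop j.val →
      ∃ p : Fin w.length, p.val + 1 = (i.1 j).val ∧ w.get p = Letter.a ∧ p ∈ Set.range i.1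
  initial_run : 0 < d → ∀ j : Fin u.length, j.val = 0 →
    List.replicate d Letter.b <+: u →
      ∀ p : Fin w.length, p < i.1 j → w.get p ≠ Letter.b

end WordPoset

/-!
An embedding of `u` in `w` is a word over `Letter × Bool`: all letters spell `w`, and the letters
marked `true` spell `u`. Right-most and `d`-normal embeddings then become the members of regular
languages. A deterministic automaton for such a language yields an automaton whose walks are the
embeddings, and its states satisfy a linear system, solved by Gaussian elimination and Arden's rule,
which makes the series counting embeddings rational.

A subword has exactly one right-most embedding, so counting these gives `ζ`. For `μ`, the number
`(-1) ^ (|u| + |v|)` is summed over the `d`-normal embeddings of `u` in the subwords `v` of `w`. The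
subwords with first letter `x` are `x` followed by the subwords of what comes after the first `x` in
`w`, so the sum can be computed by induction on `w`: the embeddings that contain this first
letter contribute `1` if `u` is a suffix of `w` starting with `x`, and the others contribute `-1` if
`x u` is a suffix of `w`. These contributions cancel unless `u = w`, that is, the signed count of
`d`-normal embeddings is a left inverse of `ζ`.
-/

namespace WordPoset

/-! ### The semiring of series -/

section factorizationSum

variable {α M : Type*} [AddCommMonoid M]

/-- The sum of `F p q` over all factorizations `w = p ++ q`, the operation by which series are
multiplied. -/
def factorizationSum (w : List α) (F : List α → List α → M) : M :=
  ∑ i ∈ Finset.range (w.length + 1), F (w.take i) (w.drop i)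

theorem factorizationSum_nil (F : List α → List α → M) : factorizationSum [] F = F [] [] := by
  simp [factorizationSum]

theorem factorizationSum_cons (x : α) (w : List α) (F : List α → List α → M) :
    factorizationSum (x :: w) F = F [] (x :: w) + factorizationSum w fun p q => F (x :: p) q := by
  rw [factorizationSum, List.length_cons, Finset.sum_range_succ', add_comm]
  rfl

theorem factorizationSum_congr {w : List α} {F G : List α → List α → M}
    (h : ∀ p q, p ++ q = w → F p q = G p q) : factorizationSum w F = factorizationSum w G :=
  Finset.sum_congr rfl fun _ _ => h _ _ (List.take_append_drop _ _)

theorem factorizationSum_zero (w : List α) : factorizationSum w (fun _ _ => (0 : M)) = 0 :=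
  Finset.sum_const_zero

theorem factorizationSum_add (w : List α) (F G : List α → List α → M) :
    (factorizationSum w fun p q => F p q + G p q) = factorizationSum w F + factorizationSum w G :=
  Finset.sum_add_distrib

theorem factorizationSum_comm {β : Type*} (u : List α) (w : List β)
    (F : List α → List α → List β → List β → M) :
    (factorizationSum u fun p q => factorizationSum w fun r s => F p q r s) =
      factorizationSum w fun r s => factorizationSum u fun p q => F p q r s :=
  Finset.sum_comm

theorem factorizationSum_assoc (w : List α) (F : List α → List α → List α → M) :
    (factorizationSum w fun v r => factorizationSum v fun p q => F p q r) =
      factorizationSum w fun p v => factorizationSum v fun q r => F p q r := by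
  induction w generalizing F with
  | nil => simp only [factorizationSum_nil]
  | cons x w ih =>
    simp only [factorizationSum_cons, factorizationSum_nil, factorizationSum_add, add_assoc,
      ih fun p q r => F (x :: p) q r]

theorem factorizationSum_prefix [DecidableEq α] (v w : List α) (F : List α → M) :
    (factorizationSum w fun p q => if p = v then F q else 0) =
      if v <+: w then F (w.drop v.length) else 0 := by
  induction w generalizing v with
  | nil => simp [factorizationSum_nil, eq_comm]
  | cons x w ih =>
    rw [factorizationSum_cons]
    rcases v with _ | ⟨y, v⟩
    · simp [factorizationSum_zero]
    · by_cases hxy : x = y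
      · subst hxy
        simpa using ih v
      · simp [hxy, Ne.symm hxy, factorizationSum_zero]

theorem factorizationSum_suffix_nil (w : List α) (F : List α → M) :
    (factorizationSum w fun p q => if q = [] then F p else 0) = F w := by
  induction w generalizing F with
  | nil => simp [factorizationSum_nil]
  | cons x w ih => simp [factorizationSum_cons, ih]

theorem mul_factorizationSum {R : Type*} [NonUnitalNonAssocSemiring R] (r : R) (w : List α)
    (F : List α → List α → R) :
    r * factorizationSum w F = factorizationSum w fun p q => r * F p q :=
  Finset.mul_sum _ _ _

theorem factorizationSum_mul {R : Type*} [NonUnitalNonAssocSemiring R] (w : List α)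
    (F : List α → List α → R) (r : R) :
    factorizationSum w F * r = factorizationSum w fun p q => F p q * r :=
  Finset.sum_mul _ _ _

end factorizationSum

namespace Series

@[ext]
theorem ext {f g : Series} (h : ∀ u w, f u w = g u w) : f = g :=
  funext₂ h

instance : Zero Series := ⟨fun _ _ => 0⟩

theorem zero_apply (u w : List Letter) : (0 : Series) u w = 0 := rfl

theorem add_apply (f g : Series) (u w : List Letter) : (f + g) u w = f u w + g u w := rfl

theorem mul_apply (f g : Series) (u w : List Letter) :
    (f * g) u w =
      factorizationSum u fun p q => factorizationSum w fun r s => f p r * g q s := rfl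

theorem mul_apply_nil (f g : Series) : (f * g) [] [] = f [] [] * g [] [] := by
  simp only [mul_apply, factorizationSum_nil]

theorem monomial_apply (c : ℤ) (u₀ w₀ u w : List Letter) :
    monomial c u₀ w₀ u w = if u = u₀ ∧ w = w₀ then c else 0 := rfl

theorem one_eq_monomial : (1 : Series) = monomial 1 [] [] := rfl

theorem one_apply (u w : List Letter) :
    (1 : Series) u w = if u = [] ∧ w = [] then 1 else 0 := rfl

theorem monomial_mul_apply (c : ℤ) (u₀ w₀ : List Letter) (f : Series) (u w : List Letter) :
    (monomial c u₀ w₀ * f) u w =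
      if u₀ <+: u ∧ w₀ <+: w then c * f (u.drop u₀.length) (w.drop w₀.length) else 0 := by
  have hite : ∀ p q, (factorizationSum w fun r s => monomial c u₀ w₀ p r * f q s) =
      if p = u₀ then factorizationSum w fun r s => if r = w₀ then c * f q s else 0 else 0 :=
    fun p q => by split_ifs with h <;> simp [monomial_apply, h, factorizationSum_zero]
  simp only [mul_apply, hite, ite_and]
  rw [factorizationSum_prefix u₀ u fun q =>
    factorizationSum w fun r s => if r = w₀ then c * f q s else 0, factorizationSum_prefix]

protected theorem mul_assoc (f g h : Series) : f * g * h = f * (g * h) := by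
  ext u w
  simp only [mul_apply, factorizationSum_mul, mul_factorizationSum, mul_assoc]
  simp only [factorizationSum_comm (M := ℤ) (u := w)]
  rw [factorizationSum_assoc u fun p q r => factorizationSum w fun v r' =>
    factorizationSum v fun p' q' => f p p' * (g q q' * h r r')]
  simp only [factorizationSum_assoc w fun p' q' r' => f _ p' * (g _ q' * h _ r')]

protected theorem mul_one (f : Series) : f * 1 = f := by
  ext u w
  have hite : ∀ p q, (factorizationSum w fun r s => f p r * (1 : Series) q s) =
      if q = [] then f p w else 0 := fun p q => by
    split_ifs with h <;>
      simp [one_apply, h, factorizationSum_suffix_nil w (f p), factorizationSum_zero]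
  simp only [mul_apply, hite]
  exact factorizationSum_suffix_nil u fun p => f p w

instance : Semiring Series where
  add_assoc f g h := by ext; simp only [add_apply, add_assoc]
  zero_add f := by ext; simp only [add_apply, zero_apply, zero_add]
  add_zero f := by ext; simp only [add_apply, zero_apply, add_zero]
  add_comm f g := by ext; simp only [add_apply, add_comm]
  nsmul := nsmulRec
  left_distrib f g h := by
    ext; simp only [add_apply, mul_apply, mul_add, factorizationSum_add]
  right_distrib f g h := by
    ext; simp only [add_apply, mul_apply, add_mul, factorizationSum_add]
  zero_mul f := by ext; simp only [mul_apply, zero_apply, zero_mul, factorizationSum_zero]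
  mul_zero f := by ext; simp only [mul_apply, zero_apply, mul_zero, factorizationSum_zero]
  mul_assoc := Series.mul_assoc
  one_mul f := by
    ext u w
    simp [one_eq_monomial, monomial_mul_apply]
  mul_one := Series.mul_one

theorem sum_apply {ι : Type*} (s : Finset ι) (f : ι → Series) (u w : List Letter) :
    (∑ i ∈ s, f i) u w = ∑ i ∈ s, f i u w := by
  induction s using Finset.cons_induction with
  | empty => rfl
  | cons i s hi ih => rw [Finset.sum_cons, Finset.sum_cons, add_apply, ih]

/-! ### Stars and linear systems -/

theorem mul_apply_congr {f g h : Series} (hf : f [] [] = 0) {u w : List Letter}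
    (hgh : ∀ u' w', u'.length + w'.length < u.length + w.length → g u' w' = h u' w') :
    (f * g) u w = (f * h) u w := by
  rw [mul_apply, mul_apply]
  refine factorizationSum_congr fun p q hpq => factorizationSum_congr fun r s hrs => ?_
  by_cases h0 : p = [] ∧ r = []
  · rw [h0.1, h0.2, hf, zero_mul, zero_mul]
  · rw [hgh q s]
    rw [← List.length_eq_zero_iff, ← List.length_eq_zero_iff] at h0
    rw [← hpq, ← hrs, List.length_append, List.length_append]
    omega

theorem star_apply {f : Series} (hf : f [] [] = 0) {n : ℕ} (u w : List Letter)
    (h : u.length + w.length < n) : f.star u w = (∑ k ∈ Finset.range n, f.power k) u w := by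
  rw [sum_apply]
  refine Finset.sum_subset (Finset.range_mono h) fun k _ hk => ?_
  rw [Finset.mem_range, not_lt] at hk
  exact power_eq_zero f hf k u w hk

theorem star_eq {f : Series} (hf : f [] [] = 0) : f.star = 1 + f * f.star := by
  ext u w
  have hpartial : ∀ n, ∑ k ∈ Finset.range (n + 1), f.power k =
      1 + f * ∑ k ∈ Finset.range n, f.power k := fun n => by
    rw [Finset.sum_range_succ', add_comm, Finset.mul_sum]
    rfl
  rw [star_apply hf u w (Nat.lt_succ_self _), hpartial, add_apply, add_apply]
  exact congrArg _ (mul_apply_congr hf fun u' w' h => (star_apply hf u' w' h).symm)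

theorem eq_of_eq_mul_add {a c x y : Series} (ha : a [] [] = 0) (hx : x = a * x + c)
    (hy : y = a * y + c) : x = y := by
  ext u w
  induction hn : u.length + w.length using Nat.strong_induction_on generalizing u w with
  | _ n ih =>
    rw [hx, hy, add_apply, add_apply,
      mul_apply_congr ha fun u' w' h => ih _ (hn ▸ h) u' w' rfl]

/-- Arden's rule. -/
theorem eq_star_mul {a c x : Series} (ha : a [] [] = 0) (hx : x = a * x + c) :
    x = a.star * c := by
  refine eq_of_eq_mul_add ha hx ?_
  conv_lhs => rw [star_eq ha, add_mul, one_mul, mul_assoc, add_comm]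

theorem IsRational.zero : IsRational 0 := by
  convert IsRational.monomial 0 [] []
  ext
  simp only [monomial_apply, zero_apply, ite_self]

theorem IsRational.sum {ι : Type*} (s : Finset ι) {f : ι → Series}
    (h : ∀ i ∈ s, IsRational (f i)) : IsRational (∑ i ∈ s, f i) :=
  Finset.sum_induction f IsRational (fun _ _ => .add) .zero h

/-- Gaussian elimination, with Arden's rule for solving a single equation. -/
theorem IsRational.of_linear_system {ι : Type*} (s : Finset ι) {a : ι → ι → Series}
    {c x : ι → Series} (ha : ∀ i j, IsRational (a i j)) (ha₀ : ∀ i j, a i j [] [] = 0)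
    (hc : ∀ i, IsRational (c i)) (hx : ∀ i ∈ s, x i = ∑ j ∈ s, a i j * x j + c i) :
    ∀ i ∈ s, IsRational (x i) := by
  induction s using Finset.cons_induction generalizing a c with
  | empty => simp
  | cons k s hk ih =>
    simp only [Finset.sum_cons, Finset.forall_mem_cons, add_assoc] at hx ⊢
    have hxk : x k = (a k k).star * (∑ j ∈ s, a k j * x j + c k) := eq_star_mul (ha₀ k k) hx.1
    have hstar : IsRational (a k k).star := .star (ha k k) (ha₀ k k)
    have hs : ∀ i ∈ s, IsRational (x i) := by
      refine ih (a := fun i j => a i j + a i k * ((a k k).star * a k j))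
        (c := fun i => c i + a i k * ((a k k).star * c k))
        (fun i j => .add (ha _ _) (.mul (ha _ _) (.mul hstar (ha _ _)))) (fun i j => ?_)
        (fun i => .add (hc _) (.mul (ha _ _) (.mul hstar (hc _)))) (fun i hi => ?_)
      · rw [add_apply, mul_apply_nil, ha₀, ha₀, zero_mul, zero_add]
      · conv_lhs => rw [hx.2 i hi, hxk]
        simp only [add_mul, Finset.sum_add_distrib, mul_add, Finset.mul_sum, mul_assoc]
        abel
    refine ⟨?_, hs⟩
    rw [hxk]
    exact .mul hstar (.add (.sum _ fun j hj => .mul (ha _ _) (hs j hj)) (hc k))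

end Series

instance : Fintype Letter := ⟨{Letter.a, Letter.b}, fun x => by cases x <;> simp⟩

/-! ### Marked words -/

section MarkedWords

variable {α : Type*}

/-- The word underlying a marked word, that is, a word in which each letter carries a Boolean
mark. -/
def underlying (p : List (α × Bool)) : List α := p.map Prod.fst

/-- The subword formed by the marked letters of a marked word. -/
def selected (p : List (α × Bool)) : List α := (p.filter Prod.snd).map Prod.fst

@[simp] theorem underlying_nil : underlying ([] : List (α × Bool)) = [] := rfl

@[simp] theorem underlying_cons (e : α × Bool) (p : List (α × Bool)) :
    underlying (e :: p) = e.1 :: underlying p := rfl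

@[simp] theorem selected_nil : selected ([] : List (α × Bool)) = [] := rfl

@[simp] theorem selected_cons_true (x : α) (p : List (α × Bool)) :
    selected ((x, true) :: p) = x :: selected p := rfl

@[simp] theorem selected_cons_false (x : α) (p : List (α × Bool)) :
    selected ((x, false) :: p) = selected p := rfl

@[simp] theorem underlying_append (p q : List (α × Bool)) :
    underlying (p ++ q) = underlying p ++ underlying q := List.map_append

@[simp] theorem selected_append (p q : List (α × Bool)) :
    selected (p ++ q) = selected p ++ selected q := by
  simp only [selected, List.filter_append, List.map_append]

@[simp] theorem length_underlying (p : List (α × Bool)) : (underlying p).length = p.length :=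
  List.length_map _

theorem selected_sublist (p : List (α × Bool)) : (selected p).Sublist (underlying p) :=
  List.filter_sublist.map _

/-- The members of `L` that mark the subword `u` of the word `w`. -/
def markings (L : Language (α × Bool)) (u w : List α) : Set (List (α × Bool)) :=
  {p | p ∈ L ∧ selected p = u ∧ underlying p = w}

theorem finite_markings [Finite α] (L : Language (α × Bool)) (u w : List α) :
    (markings L u w).Finite :=
  (List.finite_length_eq (α × Bool) w.length).subset fun p hp => by
    rw [Set.mem_ofPred_eq, ← hp.2.2, length_underlying]

open Classical in
theorem markings_nil (L : Language (α × Bool)) (u : List α) :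
    markings L u [] = if u = [] ∧ [] ∈ L then {[]} else ∅ := by
  ext p
  have hmem : p ∈ markings L u [] ↔ p ∈ L ∧ selected p = u ∧ p = [] := by
    simp only [markings, Set.mem_ofPred_eq, underlying, List.map_eq_nil_iff]
  rw [hmem]
  split_ifs with h
  · rw [Set.mem_singleton_iff, h.1]
    exact ⟨fun hp => hp.2.2, by rintro rfl; exact ⟨h.2, rfl, rfl⟩⟩
  · rw [Set.mem_empty_iff_false, iff_false]
    rintro ⟨hL, rfl, rfl⟩
    exact h ⟨rfl, hL⟩

open Classical in
theorem markings_cons (L : Language (α × Bool)) (u : List α) (x : α) (w : List α) :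
    markings L u (x :: w) =
      List.cons (x, false) '' markings (L.leftQuotient [(x, false)]) u w ∪
        if u.head? = some x then
          List.cons (x, true) '' markings (L.leftQuotient [(x, true)]) u.tail w else ∅ := by
  ext p
  rcases p with _ | ⟨⟨y, _ | _⟩, p⟩ <;> rcases u with _ | ⟨z, u⟩ <;> split_ifs <;>
    simp_all [markings, Language.mem_leftQuotient] <;> grind

end MarkedWords

/-! ### Counting series -/

/-- The series in which each `p ∈ L`, marking the subword `u` of `w`, contributes
`c ^ (|u| + |w|) u ⊗ w`. -/
noncomputable def countSeries (c : ℤ) (L : Language (Letter × Bool)) : Series :=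
  fun u w => c ^ (u.length + w.length) * (markings L u w).ncard

theorem countSeries_apply (c : ℤ) (L : Language (Letter × Bool)) (u w : List Letter) :
    countSeries c L u w = c ^ (u.length + w.length) * (markings L u w).ncard := rfl

open Classical in
theorem countSeries_nil (c : ℤ) (L : Language (Letter × Bool)) (u : List Letter) :
    countSeries c L u [] = if u = [] ∧ [] ∈ L then 1 else 0 := by
  rw [countSeries_apply, markings_nil]
  split_ifs with h
  · simp [h.1]
  · simp

theorem countSeries_cons (c : ℤ) (L : Language (Letter × Bool)) (u : List Letter) (x : Letter)
    (w : List Letter) :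
    countSeries c L u (x :: w) = c * countSeries c (L.leftQuotient [(x, false)]) u w +
      if u.head? = some x then c ^ 2 * countSeries c (L.leftQuotient [(x, true)]) u.tail w
      else 0 := by
  simp only [countSeries_apply, markings_cons, List.length_cons]
  split_ifs with h
  · obtain ⟨u, rfl⟩ := List.head?_eq_some_iff.1 h
    rw [Set.ncard_union_eq _ ((finite_markings _ _ _).image _) ((finite_markings _ _ _).image _),
      Set.ncard_image_of_injective _ List.cons_injective,
      Set.ncard_image_of_injective _ List.cons_injective, List.length_cons, List.tail_cons]
    · push_cast
      ring
    · rw [Set.disjoint_left]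
      rintro _ ⟨p, -, rfl⟩ ⟨q, -, h⟩
      simp at h
  · rw [Set.union_empty, Set.ncard_image_of_injective _ List.cons_injective]
    ring

/-- The monomial contributed to `countSeries c` by a single letter of a marked word. -/
def letterSeries (c : ℤ) (e : Letter × Bool) : Series :=
  Series.monomial (c ^ ((selected [e]).length + 1)) (selected [e]) [e.1]

theorem letterSeries_nil (c : ℤ) (e : Letter × Bool) : letterSeries c e [] [] = 0 := by
  simp [letterSeries, Series.monomial_apply]

open Classical in
theorem countSeries_eq_sum (c : ℤ) (L : Language (Letter × Bool)) :
    countSeries c L = ∑ e, letterSeries c e * countSeries c (L.leftQuotient [e]) +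
      if [] ∈ L then 1 else 0 := by
  ext u w
  have hone : (if [] ∈ L then 1 else 0 : Series) u w =
      if u = [] ∧ w = [] ∧ [] ∈ L then 1 else 0 := by
    split_ifs <;> simp_all [Series.one_apply, Series.zero_apply]
  simp only [Series.add_apply, Series.sum_apply, letterSeries, Series.monomial_mul_apply, hone,
    Fintype.sum_prod_type, Fintype.sum_bool, selected_cons_true, selected_cons_false, selected_nil]
  cases w with
  | nil => simp [countSeries_nil]
  | cons x w =>
    rw [countSeries_cons]
    simp only [List.singleton_prefix_cons_iff, and_comm (b := _ = x), ite_and,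
      Finset.sum_add_distrib, Finset.sum_ite_eq', Finset.mem_univ, if_true]
    simp [List.singleton_prefix_iff_head?_eq_some, add_comm]

theorem isRational_countSeries (c : ℤ) {L : Language (Letter × Bool)} (hL : L.IsRegular) :
    (countSeries c L).IsRational := by
  classical
  obtain ⟨σ, _, M, rfl⟩ := Language.isRegular_iff.{0, 0}.1 hL
  refine Series.IsRational.of_linear_system Finset.univ
    (a := fun s t => ∑ e, if M.step s e = t then letterSeries c e else 0)
    (c := fun s => if [] ∈ M.acceptsFrom s then 1 else 0)
    (x := fun s => countSeries c (M.acceptsFrom s))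
    (fun s t => .sum _ fun e _ => ?_) (fun s t => ?_) (fun s => ?_) (fun s _ => ?_)
    M.start (Finset.mem_univ _)
  · split_ifs
    · exact .monomial _ _ _
    · exact .zero
  · rw [Series.sum_apply]
    refine Finset.sum_eq_zero fun e _ => ?_
    split_ifs
    · exact letterSeries_nil _ _
    · rfl
  · split_ifs
    · exact .monomial _ _ _
    · exact .zero
  · have hstep : ∀ e, (M.acceptsFrom s).leftQuotient [e] = M.acceptsFrom (M.step s e) :=
      fun e => rfl
    conv_lhs => rw [countSeries_eq_sum]
    simp only [Finset.sum_mul, ite_mul, zero_mul, hstep]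
    rw [Finset.sum_comm]
    simp only [Finset.sum_ite_eq, Finset.mem_univ, if_true]

/-! ### Regular languages and automata -/

/-- A Myhill–Nerode criterion: `φ` is the state reached by reading a word from right to left. -/
theorem isRegular_of_finite {α T : Type*} [Finite T] {L : Language α} (φ : List α → T)
    (hφ : ∀ x p q, φ p = φ q → φ (x :: p) = φ (x :: q))
    (hL : ∀ p q, φ p = φ q → (p ∈ L ↔ q ∈ L)) : L.IsRegular := by
  have happend : ∀ r p q, φ p = φ q → φ (r ++ p) = φ (r ++ q) := fun r p q h => by
    induction r with
    | nil => exact h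
    | cons x r ih => exact hφ x _ _ ih
  have hfactors : L.reverse.leftQuotient.FactorsThrough (φ ∘ List.reverse) := fun p q h => by
    ext r
    simpa only [Language.mem_leftQuotient, Language.mem_reverse, List.reverse_append]
      using hL _ _ (happend r.reverse _ _ h)
  refine .of_reverse (.of_finite_range_leftQuotient ((Set.finite_range
    (Function.extend (φ ∘ List.reverse) L.reverse.leftQuotient fun _ => ⊥)).subset ?_))
  rintro _ ⟨p, rfl⟩
  exact ⟨_, hfactors.extend_apply _ p⟩

namespace Automaton

/-- The marked word read along an arc of `ofDFA`: the letter that labels a transition, and the empty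
word for an arc to the final vertex. -/
def arcWord {σ : Type} {M : DFA (Letter × Bool) σ} :
    σ × (Letter × Bool) ⊕ M.accept → List (Letter × Bool) :=
  Sum.elim (fun e => [e.2]) fun _ => []

/-- The automaton that reads a marked word as a deterministic automaton does, and from each
accepting state has an arc labelled `ε ⊗ ε` to the final vertex `none`. -/
def ofDFA {σ : Type} [Finite σ] (M : DFA (Letter × Bool) σ) (c : ℤ) : Automaton where
  V := Option σ
  E := σ × (Letter × Bool) ⊕ M.accept
  finite_V := inferInstance
  finite_E := inferInstance
  src := Sum.elim (fun e => some e.1) fun s => some s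
  tgt := Sum.elim (fun e => some (M.step e.1 e.2)) fun _ => none
  initial := some M.start
  final := none
  initial_ne_final := Option.some_ne_none _
  coeff e := c ^ ((selected (arcWord e)).length + (underlying (arcWord e)).length)
  left e := selected (arcWord e)
  right e := underlying (arcWord e)

section ofDFA

variable {σ : Type} [Finite σ] {M : DFA (Letter × Bool) σ} {c : ℤ}

/-- The marked word read along a sequence of arcs. -/
def markedWord (l : List (ofDFA M c).E) : List (Letter × Bool) := (l.map arcWord).flatten

theorem flatten_map_left (l : List (ofDFA M c).E) :
    (l.map (ofDFA M c).left).flatten = selected (markedWord l) := by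
  induction l with
  | nil => rfl
  | cons e l ih => exact (congrArg _ ih).trans (selected_append _ _).symm

theorem flatten_map_right (l : List (ofDFA M c).E) :
    (l.map (ofDFA M c).right).flatten = underlying (markedWord l) := by
  induction l with
  | nil => rfl
  | cons e l ih => exact (congrArg _ ih).trans (underlying_append _ _).symm

theorem prod_map_coeff (l : List (ofDFA M c).E) : (l.map (ofDFA M c).coeff).prod =
    c ^ (((l.map (ofDFA M c).left).flatten).length +
      ((l.map (ofDFA M c).right).flatten).length) := by
  induction l with
  | nil => simp
  | cons e l ih =>
    simp only [List.map_cons, List.prod_cons, ih, List.flatten_cons, List.length_append]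
    rw [add_add_add_comm]
    exact (pow_add c _ _).symm

theorem eq_nil_of_isWalk_none {l : List (ofDFA M c).E} (h : (ofDFA M c).IsWalk none l none) :
    l = [] := by
  rcases l with _ | ⟨_ | _, l⟩
  · rfl
  · exact absurd h.1 (Option.some_ne_none _)
  · exact absurd h.1 (Option.some_ne_none _)

theorem markedWord_mem {l : List (ofDFA M c).E} {s : σ}
    (h : (ofDFA M c).IsWalk (some s) l none) : markedWord l ∈ M.acceptsFrom s := by
  induction l generalizing s with
  | nil => exact absurd h (Option.some_ne_none _)
  | cons e l ih =>
    rcases e with ⟨t, e⟩ | t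
    · obtain rfl : t = s := Option.some_injective _ h.1
      exact ih h.2
    · obtain rfl : t.1 = s := Option.some_injective _ h.1
      rw [eq_nil_of_isWalk_none h.2]
      exact t.2

theorem eq_of_markedWord_eq {l l' : List (ofDFA M c).E} {s : σ}
    (h : (ofDFA M c).IsWalk (some s) l none) (h' : (ofDFA M c).IsWalk (some s) l' none)
    (heq : markedWord l = markedWord l') : l = l' := by
  induction l generalizing l' s with
  | nil => exact absurd h (Option.some_ne_none _)
  | cons e l ih =>
    rcases l' with _ | ⟨e', l'⟩
    · exact absurd h' (Option.some_ne_none _)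
    rcases e with ⟨t, e⟩ | t <;> rcases e' with ⟨t', e'⟩ | t'
    · obtain rfl : t = s := Option.some_injective _ h.1
      obtain rfl : t' = t := Option.some_injective _ h'.1
      obtain ⟨rfl, htail⟩ := List.cons_eq_cons.1 heq
      rw [ih h.2 h'.2 htail]
    · rw [eq_nil_of_isWalk_none h'.2] at heq
      exact absurd heq (List.cons_ne_nil _ _)
    · rw [eq_nil_of_isWalk_none h.2] at heq
      exact absurd heq.symm (List.cons_ne_nil _ _)
    · obtain rfl : t = t' := Subtype.ext (Option.some_injective _ (h.1.trans h'.1.symm))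
      rw [eq_nil_of_isWalk_none h.2, eq_nil_of_isWalk_none h'.2]

theorem exists_markedWord_eq {p : List (Letter × Bool)} {s : σ} (hp : p ∈ M.acceptsFrom s) :
    ∃ l, (ofDFA M c).IsWalk (some s) l none ∧ markedWord l = p := by
  induction p generalizing s with
  | nil => exact ⟨[Sum.inr ⟨s, hp⟩], ⟨rfl, rfl⟩, rfl⟩
  | cons e p ih =>
    obtain ⟨l, hl, rfl⟩ := ih (s := M.step s e) hp
    exact ⟨Sum.inl (s, e) :: l, ⟨rfl, hl⟩, rfl⟩

theorem nonempty_walkOn_equiv (M : DFA (Letter × Bool) σ) (c : ℤ) (u w : List Letter) :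
    Nonempty ((ofDFA M c).WalkOn u w ≃ markings M.accepts u w) := by
  refine ⟨Equiv.ofBijective (fun W => ⟨markedWord W.1.1, markedWord_mem W.1.2,
    (flatten_map_left _).symm.trans W.2.1, (flatten_map_right _).symm.trans W.2.2⟩)
    ⟨fun W W' h => ?_, fun ⟨p, hp, hu, hw⟩ => ?_⟩⟩
  · exact Subtype.ext (Subtype.ext (eq_of_markedWord_eq W.1.2 W'.1.2 (congrArg Subtype.val h)))
  · obtain ⟨l, hl, rfl⟩ := exists_markedWord_eq (c := c) hp
    exact ⟨⟨⟨l, hl⟩, (flatten_map_left l).trans hu, (flatten_map_right l).trans hw⟩, rfl⟩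

theorem walkCoeff_ofDFA (W : (ofDFA M c).Walk) : (ofDFA M c).walkCoeff W =
    c ^ (((ofDFA M c).walkLeft W).length + ((ofDFA M c).walkRight W).length) :=
  prod_map_coeff W.1

theorem accepts_ofDFA (M : DFA (Letter × Bool) σ) (c : ℤ) :
    (ofDFA M c).Accepts (countSeries c M.accepts) := fun u w => by
  obtain ⟨φ⟩ := nonempty_walkOn_equiv M c u w
  have : Finite (markings M.accepts u w) := finite_markings _ u w
  have hcoeff : ∀ W : (ofDFA M c).WalkOn u w,
      (ofDFA M c).walkCoeff W.1 = c ^ (u.length + w.length) := fun W => by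
    rw [walkCoeff_ofDFA, W.2.1, W.2.2]
  refine ⟨Finite.of_equiv _ φ.symm, ?_⟩
  have := Fintype.ofFinite (markings M.accepts u w)
  rw [← finsum_comp_equiv φ.symm, finsum_eq_sum_of_fintype]
  simp only [hcoeff]
  rw [Finset.sum_const, Finset.card_univ, ← Nat.card_eq_fintype_card, Nat.card_coe_set_eq,
    nsmul_eq_mul, mul_comm, countSeries_apply]

end ofDFA

end Automaton

theorem exists_automaton (c : ℤ) {L : Language (Letter × Bool)} (hL : L.IsRegular) :
    ∃ D : Automaton, D.Accepts (countSeries c L) ∧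
      (∀ W : D.Walk, (∃ p ∈ L, D.walkLeft W = selected p ∧ D.walkRight W = underlying p) ∧
        D.walkCoeff W = c ^ ((D.walkLeft W).length + (D.walkRight W).length)) ∧
      ∀ u w, Nonempty (D.WalkOn u w ≃ markings L u w) := by
  obtain ⟨σ, _, M, rfl⟩ := Language.isRegular_iff.{0, 0}.1 hL
  exact ⟨.ofDFA M c, Automaton.accepts_ofDFA M c, fun W => ⟨⟨_, Automaton.markedWord_mem W.2,
    Automaton.flatten_map_left _, Automaton.flatten_map_right _⟩, Automaton.walkCoeff_ofDFA W⟩,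
    Automaton.nonempty_walkOn_equiv M c⟩

/-! ### Words without long runs of `b` -/

theorem InAd.of_infix {d : ℕ} {u w : List Letter} (hw : InAd d w) (h : u <:+: w) : InAd d u :=
  fun hu => hw (hu.trans h)

theorem inAd_cons {d : ℕ} {x : Letter} {u : List Letter} :
    InAd d (x :: u) ↔ ¬ List.replicate (d + 1) Letter.b <+: x :: u ∧ InAd d u := by
  rw [InAd, List.infix_cons_iff, not_or, InAd]

/-- The length of the initial run of `b` in `u`, capped at `d + 1` and encoded by the lengths it
reaches, together with membership of `u` in `A*_d`. -/
def runProfile (d : ℕ) (u : List Letter) : (Fin (d + 2) → Prop) × Prop :=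
  (fun k => List.replicate k Letter.b <+: u, InAd d u)

section runProfile

variable {d : ℕ} {u v : List Letter}

theorem replicate_prefix_iff_of_runProfile_eq (h : runProfile d u = runProfile d v) {k : ℕ}
    (hk : k < d + 2) : List.replicate k Letter.b <+: u ↔ List.replicate k Letter.b <+: v :=
  iff_of_eq (congrFun (congrArg Prod.fst h) ⟨k, hk⟩)

theorem inAd_iff_of_runProfile_eq (h : runProfile d u = runProfile d v) : InAd d u ↔ InAd d v :=
  iff_of_eq (congrArg Prod.snd h)

theorem runProfile_cons (h : runProfile d u = runProfile d v) (x : Letter) :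
    runProfile d (x :: u) = runProfile d (x :: v) := by
  have hprefix : ∀ k < d + 2,
      (List.replicate k Letter.b <+: x :: u ↔ List.replicate k Letter.b <+: x :: v) := by
    rintro (_ | k) hk
    · simp
    · rw [List.replicate_succ, List.cons_prefix_cons, List.cons_prefix_cons,
        replicate_prefix_iff_of_runProfile_eq h (Nat.lt_of_succ_lt hk)]
  refine Prod.ext (funext fun k => propext (hprefix k k.2)) (propext ?_)
  change InAd d (x :: u) ↔ InAd d (x :: v)
  rw [inAd_cons, inAd_cons, hprefix _ (Nat.lt_succ_self _), inAd_iff_of_runProfile_eq h]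

theorem runProfile_selected_cons {p q : List (Letter × Bool)}
    (h : runProfile d (selected p) = runProfile d (selected q)) (e : Letter × Bool) :
    runProfile d (selected (e :: p)) = runProfile d (selected (e :: q)) := by
  obtain ⟨x, _ | _⟩ := e
  · exact h
  · exact runProfile_cons h x

end runProfile

/-- The members of `L` that mark a word of `A*_d` in a word of `A*_d`. -/
def restrict (d : ℕ) (L : Language (Letter × Bool)) : Language (Letter × Bool) :=
  L ⊓ ({p | InAd d (selected p)} ⊓ {p | InAd d (underlying p)} : Set (List (Letter × Bool)))

theorem mem_restrict {d : ℕ} {L : Language (Letter × Bool)} {p : List (Letter × Bool)} :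
    p ∈ restrict d L ↔ p ∈ L ∧ InAd d (selected p) ∧ InAd d (underlying p) := Iff.rfl

theorem isRegular_restrict (d : ℕ) {L : Language (Letter × Bool)} (hL : L.IsRegular) :
    (restrict d L).IsRegular := by
  refine hL.inf (Language.IsRegular.inf ?_ ?_)
  · exact isRegular_of_finite (fun p => runProfile d (selected p))
      (fun e p q h => runProfile_selected_cons h e) fun p q h => inAd_iff_of_runProfile_eq h
  · exact isRegular_of_finite (fun p => runProfile d (underlying p))
      (fun e p q h => runProfile_cons h e.1) fun p q h => inAd_iff_of_runProfile_eq h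

theorem markings_restrict {d : ℕ} (L : Language (Letter × Bool)) {u w : List Letter}
    (hu : InAd d u) (hw : InAd d w) : markings (restrict d L) u w = markings L u w := by
  ext p
  refine and_congr_left ?_
  rintro ⟨rfl, rfl⟩
  exact mem_restrict.trans (and_iff_left ⟨hu, hw⟩)

theorem markings_restrict_eq_empty {d : ℕ} (L : Language (Letter × Bool)) {u w : List Letter}
    (h : ¬ (InAd d u ∧ InAd d w)) : markings (restrict d L) u w = ∅ := by
  refine Set.eq_empty_of_forall_notMem ?_
  rintro p ⟨hp, rfl, rfl⟩
  exact h (mem_restrict.1 hp).2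

theorem seriesOf_eq_countSeries {d : ℕ} {f : Word d → Word d → ℤ} {c : ℤ}
    {L : Language (Letter × Bool)} (h : ∀ u w, f u w = countSeries c L u.letters w.letters) :
    seriesOf d f = countSeries c (restrict d L) := by
  ext u w
  rw [seriesOf]
  split_ifs with huw
  · rw [h, countSeries_apply, countSeries_apply, markings_restrict L huw.1 huw.2]
  · rw [countSeries_apply, markings_restrict_eq_empty L huw, Set.ncard_empty, Nat.cast_zero,
      mul_zero]

theorem exists_automaton_restrict (c : ℤ) (d : ℕ) {L : Language (Letter × Bool)}
    (hL : L.IsRegular) :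
    ∃ D : Automaton, D.Accepts (countSeries c (restrict d L)) ∧
      (∀ W : D.Walk, InAd d (D.walkLeft W) ∧ InAd d (D.walkRight W) ∧
        D.walkCoeff W = c ^ ((D.walkLeft W).length + (D.walkRight W).length)) ∧
      ∀ u w : Word d, Nonempty (D.WalkOn u.letters w.letters ≃ markings L u.letters w.letters) := by
  obtain ⟨D, hacc, hwalk, hequiv⟩ := exists_automaton c (isRegular_restrict d hL)
  refine ⟨D, hacc, fun W => ?_, fun u w => ?_⟩
  · obtain ⟨⟨p, hp, hl, hr⟩, hcoeff⟩ := hwalk W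
    exact ⟨hl ▸ (mem_restrict.1 hp).2.1, hr ▸ (mem_restrict.1 hp).2.2, hcoeff⟩
  · exact markings_restrict L u.mem w.mem ▸ hequiv u.letters w.letters

theorem countSeries_congr (c : ℤ) {L L' : Language (Letter × Bool)} {u w : List Letter}
    (h : ∀ p, selected p = u → underlying p = w → (p ∈ L ↔ p ∈ L')) :
    countSeries c L u w = countSeries c L' u w := by
  rw [countSeries_apply, countSeries_apply]
  congr 3
  ext p
  exact and_congr_left fun hp => h p hp.1 hp.2

theorem countSeries_eq_zero (c : ℤ) {L : Language (Letter × Bool)} {u w : List Letter}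
    (h : ∀ p, selected p = u → underlying p = w → p ∉ L) : countSeries c L u w = 0 := by
  rw [countSeries_apply, Set.eq_empty_of_forall_notMem (s := markings L u w), Set.ncard_empty,
    Nat.cast_zero, mul_zero]
  rintro p ⟨hp, hu, hw⟩
  exact h p hu hw hp

/-! ### The zeta function and right-most embeddings -/

/-- The marking is right-most: between a marked letter and the next one, or the end of the word,
there is no letter equal to the former. The optional letter `last` stands for the marked letter that
precedes the word. -/
def IsRightmostMarking {α : Type*} (last : Option α) : List (α × Bool) → Prop
  | [] => True
  | (x, true) :: p => IsRightmostMarking (some x) p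
  | (x, false) :: p => last ≠ some x ∧ IsRightmostMarking last p

/-- The language of right-most markings. -/
def rightmostLanguage {α : Type*} (last : Option α) : Language (α × Bool) :=
  {p | IsRightmostMarking last p}

theorem isRegular_rightmostLanguage {α : Type*} [Finite α] (last : Option α) :
    (rightmostLanguage last).IsRegular := by
  refine isRegular_of_finite (fun p s => IsRightmostMarking s p) (fun e p q h => ?_)
    fun p q h => iff_of_eq (congrFun h last)
  obtain ⟨x, _ | _⟩ := e <;> funext s <;> have hs := congrFun h <;>
    simp only [IsRightmostMarking, hs]

theorem countSeries_rightmost_true (c : ℤ) (last : Option Letter) (x : Letter)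
    (u w : List Letter) :
    countSeries c ((rightmostLanguage last).leftQuotient [(x, true)]) u w =
      countSeries c (rightmostLanguage (some x)) u w := rfl

theorem countSeries_rightmost_false (c : ℤ) (last : Option Letter) (x : Letter)
    (u w : List Letter) :
    countSeries c ((rightmostLanguage last).leftQuotient [(x, false)]) u w =
      if last = some x then 0 else countSeries c (rightmostLanguage last) u w := by
  split_ifs with h
  · exact countSeries_eq_zero c fun p _ _ hp => hp.1 h
  · exact countSeries_congr c fun p _ _ => and_iff_right (a := last ≠ some x) h

theorem countSeries_rightmost (last : Option Letter) (u w : List Letter) :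
    countSeries 1 (rightmostLanguage last) u w =
      if u.Sublist w ∧ ∀ x ∈ last, ¬ (x :: u).Sublist w then 1 else 0 := by
  induction w generalizing last u with
  | nil =>
    classical
    rw [countSeries_nil]
    refine if_congr ?_ rfl rfl
    simp only [List.sublist_nil, reduceCtorEq, not_false_eq_true, implies_true]
    exact and_congr_right fun _ => iff_of_true trivial trivial
  | cons z w ih =>
    rw [countSeries_cons, countSeries_rightmost_true, countSeries_rightmost_false, ih, ih]
    have htail : ∀ x v, (x :: v).Sublist w → v.Sublist w := fun x v =>
      (List.sublist_cons_self x v).trans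
    rcases u with _ | ⟨y, u⟩ <;> rcases last with _ | x <;>
      simp [List.cons_sublist_cons'] <;> grind

theorem zetaSeries_eq (d : ℕ) :
    zetaSeries d = countSeries 1 (restrict d (rightmostLanguage none)) := by
  refine seriesOf_eq_countSeries fun u w => ?_
  rw [countSeries_rightmost, IncidenceAlgebra.zeta_apply]
  refine if_congr (iff_self_and.2 fun _ x hx => ?_) rfl rfl
  exact (Option.not_mem_none x hx).elim

instance (u w : List Letter) : Finite (Embedding u w) := Subtype.finite

theorem Embedding.sublist {u w : List Letter} (i : Embedding u w) : u.Sublist w :=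
  List.sublist_iff_exists_fin_orderEmbedding_get_eq.2 ⟨i.1, i.2⟩

/-- The pointwise maximum of two embeddings. -/
def Embedding.max {u w : List Letter} (i i' : Embedding u w) : Embedding u w :=
  ⟨OrderEmbedding.ofStrictMono (fun j => Max.max (i.1 j) (i'.1 j))
    (fun _ _ h => max_lt_max (i.1.strictMono h) (i'.1.strictMono h)), fun j => by
      change u.get j = w.get (Max.max (i.1 j) (i'.1 j))
      rcases max_choice (i.1 j) (i'.1 j) with h | h <;> rw [h]
      · exact i.2 j
      · exact i'.2 j⟩

theorem exists_isRightmost {u w : List Letter} (h : u.Sublist w) :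
    ∃ i : Embedding u w, i.IsRightmost := by
  obtain ⟨i₀, h₀⟩ := List.sublist_iff_exists_fin_orderEmbedding_get_eq.1 h
  have : Nonempty (Embedding u w) := ⟨⟨i₀, h₀⟩⟩
  have hdir : Directed (fun i i' : Embedding u w => ∀ j, i.1 j ≤ i'.1 j) id := fun i i' =>
    ⟨i.max i', fun _ => le_max_left _ _, fun _ => le_max_right _ _⟩
  have : IsTrans (Embedding u w) (fun i i' => ∀ j, i.1 j ≤ i'.1 j) :=
    ⟨fun _ _ _ h₁ h₂ j => (h₁ j).trans (h₂ j)⟩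
  exact hdir.finite_le id

theorem subsingleton_isRightmost (u w : List Letter) :
    Subsingleton {i : Embedding u w // i.IsRightmost} :=
  ⟨fun i i' => Subtype.ext (Subtype.ext (DFunLike.ext _ _ fun j =>
    le_antisymm (i'.2 i.1 j) (i.2 i'.1 j)))⟩

theorem nonempty_markings_equiv_rightmost (u w : List Letter) :
    Nonempty (markings (rightmostLanguage none) u w ≃ {i : Embedding u w // i.IsRightmost}) := by
  have : Finite (markings (rightmostLanguage none) u w) := finite_markings _ u w
  rw [← Finite.card_eq, Nat.card_coe_set_eq]
  have hcount := countSeries_rightmost none u w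
  simp only [countSeries_apply, one_pow, one_mul, Option.not_mem_none, false_imp_iff,
    implies_true, and_true] at hcount
  split_ifs at hcount with h
  · obtain ⟨i, hi⟩ := exists_isRightmost h
    rw [Nat.cast_eq_one.1 hcount]
    exact (Nat.card_eq_one_iff_unique.2 ⟨subsingleton_isRightmost u w, ⟨⟨i, hi⟩⟩⟩).symm
  · rw [Nat.cast_eq_zero.1 hcount]
    have : IsEmpty {i : Embedding u w // i.IsRightmost} := ⟨fun i => h i.1.sublist⟩
    exact Nat.card_of_isEmpty.symm

/-! ### Sums over subwords -/

theorem cons_sublist_append_cons {α : Type*} {x : α} {r : List α} (hr : x ∉ r) (u w : List α) :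
    (x :: u).Sublist (r ++ x :: w) ↔ u.Sublist w := by
  induction r with
  | nil => exact List.cons_sublist_cons
  | cons y r ih =>
    rw [List.mem_cons, not_or] at hr
    rw [List.cons_append, List.cons_sublist_cons', ih hr.2]
    exact or_iff_left fun h => hr.1 h.1

section subwordSum

variable {α M : Type*} [DecidableEq α] [AddCommMonoid M]

/-- The sum of `g` over the distinct subwords of `w`. -/
def subwordSum (g : List α → M) (w : List α) : M :=
  ∑ v ∈ w.sublists.toFinset, g v

/-- The sum of `g` over the distinct subwords of `w` with first letter `x`. -/
def subwordSumHead (g : List α → M) (x : α) (w : List α) : M :=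
  ∑ v ∈ w.sublists.toFinset with v.head? = some x, g v

theorem subwordSum_eq [Fintype α] (g : List α → M) (w : List α) :
    subwordSum g w = g [] + ∑ x, subwordSumHead g x w := by
  have hnil : {v ∈ w.sublists.toFinset | v.head? = none} = {[]} := by
    ext v
    simp only [Finset.mem_filter, List.mem_toFinset, List.mem_sublists, List.head?_eq_none_iff,
      Finset.mem_singleton, and_iff_right_iff_imp]
    rintro rfl
    exact List.nil_sublist w
  rw [subwordSum, ← Finset.sum_fiberwise _ List.head?, Fintype.sum_option, hnil,
    Finset.sum_singleton]
  rfl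

theorem subwordSumHead_append_cons (g : List α → M) {x : α} {r : List α} (hr : x ∉ r)
    (w : List α) : subwordSumHead g x (r ++ x :: w) = subwordSum (fun v => g (x :: v)) w := by
  rw [subwordSumHead, subwordSum, ← Finset.sum_image (f := g) List.cons_injective.injOn]
  congr 1
  ext v
  simp only [Finset.mem_filter, List.mem_toFinset, List.mem_sublists, Finset.mem_image]
  constructor
  · rintro ⟨h, hx⟩
    obtain ⟨v, rfl⟩ := List.head?_eq_some_iff.1 hx
    exact ⟨v, (cons_sublist_append_cons hr v w).1 h, rfl⟩
  · rintro ⟨v, h, rfl⟩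
    exact ⟨(cons_sublist_append_cons hr v w).2 h, rfl⟩

theorem subwordSumHead_of_notMem (g : List α → M) {x : α} {w : List α} (h : x ∉ w) :
    subwordSumHead g x w = 0 := by
  rw [subwordSumHead, Finset.filter_false_of_mem, Finset.sum_empty]
  intro v hv hx
  obtain ⟨v, rfl⟩ := List.head?_eq_some_iff.1 hx
  rw [List.mem_toFinset, List.mem_sublists] at hv
  exact h (hv.subset List.mem_cons_self)

end subwordSum

theorem cons_suffix_append_cons {α : Type*} {x : α} {r : List α} (hr : x ∉ r) (u w : List α) :
    x :: u <:+ r ++ x :: w ↔ x :: u <:+ x :: w := by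
  induction r with
  | nil => rfl
  | cons y r ih =>
    rw [List.mem_cons, not_or] at hr
    rw [List.cons_append, List.suffix_cons_iff, ih hr.2]
    exact or_iff_right fun h => hr.1 (List.cons_eq_cons.1 h).1

theorem cons_suffix_unique {α : Type*} {x y : α} {u w : List α} (hx : x :: u <:+ w)
    (hy : y :: u <:+ w) : x = y :=
  (List.cons_eq_cons.1 ((List.suffix_of_suffix_length_le hx hy le_rfl).eq_of_length rfl)).1

theorem not_cons_suffix_self {α : Type*} (x : α) (u : List α) : ¬ x :: u <:+ u := fun h =>
  absurd h.length_le (Nat.not_succ_le_self _)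

theorem suffix_iff_eq_or_exists_cons_suffix {α : Type*} (u w : List α) :
    u <:+ w ↔ u = w ∨ ∃ x, x :: u <:+ w := by
  refine ⟨?_, fun h => h.elim (fun h => h ▸ List.suffix_rfl)
    fun ⟨x, hx⟩ => (List.suffix_cons x u).trans hx⟩
  rintro ⟨r, rfl⟩
  rcases List.eq_nil_or_concat r with rfl | ⟨r, x, rfl⟩
  · exact Or.inl rfl
  · exact Or.inr ⟨x, r, by rw [List.concat_eq_append, List.append_assoc]; rfl⟩

section ite_suffix

variable {α : Type*} [Fintype α] [DecidableEq α]

theorem sum_ite_head_suffix (u w : List α) :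
    (if u = [] then 1 else 0 : ℤ) + (∑ x, if u.head? = some x ∧ u <:+ w then 1 else 0) =
      if u <:+ w then 1 else 0 := by
  cases u with
  | nil => simp only [List.head?_nil, reduceCtorEq, false_and, if_false, if_true,
      Finset.sum_const_zero, add_zero, List.nil_suffix]
  | cons y u => simp only [List.head?_cons, Option.some_inj, reduceCtorEq, ite_and, if_false,
      Finset.sum_ite_eq, Finset.mem_univ, if_true, zero_add]

theorem ite_suffix_sub_sum (last : Option α) (u w : List α) :
    (if u <:+ w then 1 else 0 : ℤ) - (∑ x, if last ≠ some x ∧ x :: u <:+ w then 1 else 0) =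
      if u = w ∨ ∃ x ∈ last, x :: u <:+ w then 1 else 0 := by
  by_cases h : ∃ x, x :: u <:+ w
  · obtain ⟨x, hx⟩ := h
    have hiff : ∀ y, y :: u <:+ w ↔ y = x := fun y =>
      ⟨fun hy => cons_suffix_unique hy hx, fun hy => hy ▸ hx⟩
    have hne : u ≠ w := by
      rintro rfl
      exact not_cons_suffix_self x u hx
    simp only [hiff, (suffix_iff_eq_or_exists_cons_suffix u w).2 (Or.inr ⟨x, hx⟩), and_comm,
      ite_and, Finset.sum_ite_eq', Finset.mem_univ, hne, false_or, if_true, exists_eq_left,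
      Option.mem_def]
    by_cases hlast : last = some x <;> simp [hlast]
  · simp only [suffix_iff_eq_or_exists_cons_suffix u w, or_false, not_exists.1 h, and_false,
      exists_false, if_false, Finset.sum_const_zero, sub_zero]

end ite_suffix

/-! ### The Möbius function -/

/-- `u` starts with a nonempty run of `d` letters `b`. -/
def StartsWithRun (d : ℕ) (u : List Letter) : Prop :=
  0 < d ∧ List.replicate d Letter.b <+: u

theorem StartsWithRun.not_inAd_cons {d : ℕ} {u : List Letter} (h : StartsWithRun d u) :
    ¬ InAd d (Letter.b :: u) := fun hb => (inAd_cons.1 hb).1 <| by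
  rw [List.replicate_succ, List.cons_prefix_cons]
  exact ⟨rfl, h.2⟩

theorem not_startsWithRun_nil (d : ℕ) : ¬ StartsWithRun d [] := fun h =>
  h.1.ne' ((List.replicate_eq_nil_iff _).1 (List.prefix_nil.1 h.2))

/-- The normality condition on the marking of a word, given what precedes it: `last` is the
preceding letter, and `good` says that a run of `d` letters `b` may start to be marked, because the
preceding letter is a marked `a`, or because nothing has been marked and no `b` has occurred. -/
def IsNormalMarking (d : ℕ) : Option Letter → Prop → List (Letter × Bool) → Prop
  | _, _, [] => True
  | _, good, (x, true) :: p =>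
    (StartsWithRun d (x :: selected p) → good) ∧ IsNormalMarking d (some x) (x = Letter.a) p
  | last, good, (x, false) :: p =>
    last ≠ some x ∧ IsNormalMarking d (some x) (x = Letter.a ∧ good) p

/-- The language of normal markings. -/
def normalLanguage (d : ℕ) (last : Option Letter) (good : Prop) : Language (Letter × Bool) :=
  {p | IsNormalMarking d last good p}

theorem isRegular_normalLanguage (d : ℕ) (last : Option Letter) (good : Prop) :
    (normalLanguage d last good).IsRegular := by
  refine isRegular_of_finite
    (fun p => (runProfile d (selected p), fun last good => IsNormalMarking d last good p))
    (fun e p q h => ?_) fun p q h => iff_of_eq (congrFun₂ (congrArg Prod.snd h) last good)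
  obtain ⟨hrun, hnormal⟩ := Prod.mk.inj h
  refine Prod.ext (runProfile_selected_cons hrun e) (funext₂ fun last good => ?_)
  have hnormal := congrFun₂ hnormal
  obtain ⟨x, _ | _⟩ := e
  · simp only [IsNormalMarking, hnormal]
  · simp only [IsNormalMarking, hnormal, StartsWithRun,
      replicate_prefix_iff_of_runProfile_eq (runProfile_cons hrun x)
        (Nat.lt_add_of_pos_right two_pos)]

theorem countSeries_normal_false (c : ℤ) (d : ℕ) (last : Option Letter) (good : Prop)
    (x : Letter) (u w : List Letter) :
    countSeries c ((normalLanguage d last good).leftQuotient [(x, false)]) u w =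
      if last = some x then 0
      else countSeries c (normalLanguage d (some x) (x = Letter.a ∧ good)) u w := by
  split_ifs with h
  · exact countSeries_eq_zero c fun p _ _ hp => hp.1 h
  · exact countSeries_congr c fun p _ _ => and_iff_right (a := last ≠ some x) h

open Classical in
theorem countSeries_normal_true (c : ℤ) (d : ℕ) (last : Option Letter) (good : Prop)
    (x : Letter) (u w : List Letter) :
    countSeries c ((normalLanguage d last good).leftQuotient [(x, true)]) u w =
      if StartsWithRun d (x :: u) → good then
        countSeries c (normalLanguage d (some x) (x = Letter.a)) u w
      else 0 := by
  split_ifs with h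
  · refine countSeries_congr c ?_
    rintro p rfl -
    exact and_iff_right h
  · refine countSeries_eq_zero c ?_
    rintro p rfl - hp
    exact h hp.1

/-- The signed number of normal markings of `u` in subwords of `w`. -/
noncomputable def normalSum (d : ℕ) (last : Option Letter) (good : Prop) (u w : List Letter) : ℤ :=
  subwordSum (countSeries (-1) (normalLanguage d last good) u) w

open Classical in
/-- The closed form of `normalSum` on words of `A*_d`; see `normalSum_eq`. -/
noncomputable def normalSumValue (d : ℕ) (last : Option Letter) (good : Prop)
    (u w : List Letter) : ℤ :=
  if (StartsWithRun d u → good) ∧ (u = w ∨ ∃ x ∈ last, x :: u <:+ w) then 1 else 0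

section normalSum

variable {d : ℕ} {u w : List Letter}

open Classical in
theorem normalSumValue_some (x : Letter) (good : Prop) :
    normalSumValue d (some x) good u w =
      if (StartsWithRun d u → good) ∧ x :: u <:+ x :: w then 1 else 0 := by
  refine if_congr (and_congr_right fun _ => ?_) rfl rfl
  simp only [Option.mem_some_iff, exists_eq_left', List.suffix_cons_iff, List.cons.injEq, true_and]

open Classical in
theorem subwordSum_normal_false {x : Letter} {last : Option Letter} {good : Prop}
    (hw : InAd d (x :: w))
    (ih : ∀ last good, normalSum d last good u w = normalSumValue d last good u w) :
    subwordSum (countSeries (-1) ((normalLanguage d last good).leftQuotient [(x, false)]) u) w =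
      if (StartsWithRun d u → good) ∧ last ≠ some x ∧ x :: u <:+ x :: w then 1 else 0 := by
  simp only [subwordSum, countSeries_normal_false]
  by_cases hlast : last = some x
  · simp only [hlast, if_true, Finset.sum_const_zero, ne_eq, not_true_eq_false, false_and,
      and_false, if_false]
  simp only [hlast, if_false, ne_eq, not_false_eq_true, true_and]
  have hrun_eq : x :: u <:+ x :: w → StartsWithRun d u → x = Letter.a := fun hsuffix hrun => by
    cases x
    · rfl
    · exact absurd (hw.of_infix hsuffix.isInfix) hrun.not_inAd_cons
  refine (ih _ _).trans ((normalSumValue_some x _).trans ?_)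
  congr 1
  exact propext (and_congr_left fun hsuffix => forall_congr' fun hrun =>
    and_iff_right (hrun_eq hsuffix hrun))

open Classical in
theorem subwordSum_normal_true {x : Letter} {last : Option Letter} {good : Prop}
    (hu : InAd d (x :: u))
    (ih : ∀ last good, normalSum d last good u w = normalSumValue d last good u w) :
    subwordSum (countSeries (-1) ((normalLanguage d last good).leftQuotient [(x, true)]) u) w =
      if (StartsWithRun d (x :: u) → good) ∧ x :: u <:+ x :: w then 1 else 0 := by
  simp only [subwordSum, countSeries_normal_true]
  by_cases hgood : StartsWithRun d (x :: u) → good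
  · simp only [if_pos hgood, and_iff_right hgood]
    have hrun_eq : StartsWithRun d u → x = Letter.a := fun hrun => by
      cases x
      · rfl
      · exact absurd hu hrun.not_inAd_cons
    refine (ih _ _).trans ((normalSumValue_some x _).trans ?_)
    congr 1
    exact propext (and_iff_right hrun_eq)
  · simp only [hgood, if_false, Finset.sum_const_zero, false_and]

open Classical in
theorem subwordSumHead_normal (last : Option Letter) (good : Prop) (x : Letter) (hu : InAd d u)
    (hw : InAd d w)
    (ih : ∀ w', w'.length < w.length → InAd d w' → ∀ u, InAd d u → ∀ last good,
      normalSum d last good u w' = normalSumValue d last good u w') :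
    subwordSumHead (countSeries (-1) (normalLanguage d last good) u) x w =
      if StartsWithRun d u → good then
        (if u.head? = some x ∧ u <:+ w then 1 else 0) -
          if last ≠ some x ∧ x :: u <:+ w then 1 else 0
      else 0 := by
  by_cases hx : x ∈ w
  · obtain ⟨r, w', rfl, hr⟩ := List.eq_append_cons_of_mem hx
    have hxw' : InAd d (x :: w') := hw.of_infix (List.suffix_append r _).isInfix
    have hw' : InAd d w' := (inAd_cons.1 hxw').2
    have ih' := ih w' (by rw [List.length_append, List.length_cons]; omega) hw'
    have hsplit : subwordSum
        (fun v => countSeries (-1) (normalLanguage d last good) u (x :: v)) w' =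
        -subwordSum (countSeries (-1)
          ((normalLanguage d last good).leftQuotient [(x, false)]) u) w' +
        if u.head? = some x then subwordSum (countSeries (-1)
          ((normalLanguage d last good).leftQuotient [(x, true)]) u.tail) w' else 0 := by
      simp only [subwordSum, countSeries_cons, Finset.sum_add_distrib, neg_mul, one_mul,
        Finset.sum_neg_distrib, Finset.sum_ite_irrel, Finset.sum_const_zero, even_two,
        Even.neg_pow, one_pow]
    rw [subwordSumHead_append_cons _ hr, hsplit, subwordSum_normal_false hxw' (ih' u hu)]
    simp only [cons_suffix_append_cons hr]
    by_cases hhead : u.head? = some x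
    · obtain ⟨u, rfl⟩ := List.head?_eq_some_iff.1 hhead
      rw [List.tail_cons, subwordSum_normal_true hu (ih' u (inAd_cons.1 hu).2)]
      simp only [cons_suffix_append_cons hr]
      by_cases hgood : StartsWithRun d (x :: u) → good
      · simp only [eq_true hgood, hhead, if_true, true_and]
        ring
      · simp only [eq_false hgood, if_false, false_and, ite_self, neg_zero, add_zero]
    · simp only [hhead, if_false, false_and, zero_sub, add_zero]
      by_cases hgood : StartsWithRun d u → good
      · simp only [eq_true hgood, true_and, if_true]
      · simp only [eq_false hgood, false_and, if_false, neg_zero]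
  · have hhead : ¬ (u.head? = some x ∧ u <:+ w) := fun h =>
      hx (h.2.subset (List.mem_of_mem_head? h.1))
    have hcons : ¬ (last ≠ some x ∧ x :: u <:+ w) := fun h => hx (h.2.subset List.mem_cons_self)
    rw [subwordSumHead_of_notMem _ hx, if_neg hhead, if_neg hcons, sub_zero, ite_self]

theorem normalSum_eq (hw : InAd d w) (hu : InAd d u) (last : Option Letter) (good : Prop) :
    normalSum d last good u w = normalSumValue d last good u w := by
  classical
  induction hn : w.length using Nat.strong_induction_on generalizing last good u w with
  | _ n ih =>
    subst hn
    have hhead := fun x => subwordSumHead_normal last good x hu hw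
      fun w' hl hw' u hu last good => ih _ hl hw' hu last good rfl
    have hnil : [] ∈ normalLanguage d last good := trivial
    rw [normalSum, normalSumValue, subwordSum_eq, countSeries_nil]
    simp only [hhead, hnil, and_true]
    by_cases hgood : StartsWithRun d u → good
    · simp only [eq_true hgood, if_true, true_and, Finset.sum_sub_distrib]
      rw [← add_sub_assoc, sum_ite_head_suffix, ite_suffix_sub_sum]
    · have hne : u ≠ [] := by
        rintro rfl
        exact hgood fun h => absurd h (not_startsWithRun_nil d)
      simp only [eq_false hgood, hne, if_false, false_and, Finset.sum_const_zero, add_zero]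

end normalSum

theorem IsNormalMarking.replicate_prefix_selected {d k : ℕ} {good : Prop}
    {p : List (Letter × Bool)} (h : IsNormalMarking d (some Letter.b) good p)
    (hk : List.replicate k Letter.b <+: underlying p) :
    List.replicate k Letter.b <+: selected p := by
  induction k generalizing good p with
  | zero => exact List.nil_prefix
  | succ k ih =>
    obtain _ | ⟨⟨x, m⟩, p⟩ := p
    · exact absurd (List.prefix_nil.1 hk) (List.cons_ne_nil _ _)
    obtain ⟨rfl, htail_prefix⟩ := List.cons_prefix_cons.1 hk
    cases m
    · exact absurd rfl h.1
    · exact List.cons_prefix_cons.2 ⟨rfl, ih h.2 htail_prefix⟩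

theorem IsNormalMarking.not_replicate_prefix {d : ℕ} (hd : 0 < d) {p : List (Letter × Bool)}
    (h : IsNormalMarking d (some Letter.b) False p) :
    ¬ List.replicate d Letter.b <+: underlying p := by
  intro hk
  have hsel := h.replicate_prefix_selected hk
  obtain ⟨k, rfl⟩ := Nat.exists_eq_add_one_of_ne_zero hd.ne'
  obtain _ | ⟨⟨x, m⟩, p⟩ := p
  · exact absurd (List.prefix_nil.1 hk) (List.cons_ne_nil _ _)
  obtain ⟨rfl, -⟩ := List.cons_prefix_cons.1 hk
  cases m
  · exact h.1 rfl
  · exact h.1 ⟨hd, hsel⟩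

theorem IsNormalMarking.inAd_underlying {d : ℕ} (hd : 0 < d) {last : Option Letter} {good : Prop}
    {p : List (Letter × Bool)} (h : IsNormalMarking d last good p) : InAd d (underlying p) := by
  induction p generalizing last good with
  | nil => exact fun h => List.cons_ne_nil _ _ (List.infix_nil.1 h)
  | cons e p ih =>
    obtain ⟨x, m⟩ := e
    have htail : ∃ good', IsNormalMarking d (some x) (x = Letter.a ∧ good') p := by
      cases m
      · exact ⟨good, h.2⟩
      · exact ⟨True, (and_true (x = Letter.a)).symm ▸ h.2⟩
    obtain ⟨good', htail⟩ := htail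
    refine inAd_cons.2 ⟨fun hk => ?_, ih htail⟩
    obtain ⟨rfl, htail_prefix⟩ := List.cons_prefix_cons.1 hk
    simp only [reduceCtorEq, false_and] at htail
    exact htail.not_replicate_prefix hd htail_prefix

theorem inAd_of_mem_normalLanguage {d : ℕ} {last : Option Letter} {good : Prop}
    {p : List (Letter × Bool)} {w : List Letter} (hp : p ∈ normalLanguage d last good)
    (hw : InAd d w) (hpw : (underlying p).Sublist w) : InAd d (underlying p) := by
  rcases Nat.eq_zero_or_pos d with rfl | hd
  · simp only [InAd, zero_add, List.replicate_one, List.singleton_infix_iff] at hw ⊢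
    exact fun hb => hw (hpw.subset hb)
  · exact IsNormalMarking.inAd_underlying hd hp

/-- The signed number of normal markings, as an element of the incidence algebra. -/
noncomputable def normalCount (d : ℕ) : IncidenceAlgebra ℤ (Word d) where
  toFun u w := countSeries (-1) (normalLanguage d none True) u.letters w.letters
  eq_zero_of_not_le' u w h := countSeries_eq_zero _ fun p hu hw _ =>
    h (hu ▸ hw ▸ selected_sublist p : u.letters.Sublist w.letters)

theorem normalCount_mul_zeta_apply {d : ℕ} (u w : Word d) :
    (normalCount d * IncidenceAlgebra.zeta ℤ : IncidenceAlgebra ℤ (Word d)) u w =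
      normalSum d none True u.letters w.letters := by
  have hzeta : ∀ v ∈ Finset.Icc u w, normalCount d u v * IncidenceAlgebra.zeta ℤ v w =
      countSeries (-1) (normalLanguage d none True) u.letters v.letters := fun v hv => by
    rw [IncidenceAlgebra.zeta_of_le (Finset.mem_Icc.1 hv).2, mul_one]
    rfl
  rw [IncidenceAlgebra.mul_apply, Finset.sum_congr rfl hzeta, normalSum, subwordSum,
    ← Finset.sum_image (g := Word.letters) fun _ _ _ _ h => Word.ext h]
  refine Finset.sum_subset (fun v hv => ?_) fun v hv hv' => ?_
  · obtain ⟨v, hvI, rfl⟩ := Finset.mem_image.1 hv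
    exact List.mem_toFinset.2 (List.mem_sublists.2 (Finset.mem_Icc.1 hvI).2)
  · rw [List.mem_toFinset, List.mem_sublists] at hv
    refine countSeries_eq_zero _ ?_
    rintro p hu rfl hp
    have huv : u.letters.Sublist (underlying p) := hu ▸ selected_sublist p
    exact hv' (Finset.mem_image.2 ⟨⟨_, inAd_of_mem_normalLanguage hp w.mem hv⟩,
      Finset.mem_Icc.2 ⟨huv, hv⟩, rfl⟩)

theorem normalCount_mul_zeta (d : ℕ) : normalCount d * IncidenceAlgebra.zeta ℤ = 1 := by
  ext u w -
  rw [normalCount_mul_zeta_apply, normalSum_eq w.mem u.mem, IncidenceAlgebra.one_apply]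
  simp only [normalSumValue, implies_true, true_and, Option.not_mem_none, false_and, exists_false,
    or_false, Word.ext_iff]

theorem muSeries_eq (d : ℕ) :
    muSeries d = countSeries (-1) (restrict d (normalLanguage d none True)) := by
  have hmu : normalCount d = IncidenceAlgebra.mu ℤ :=
    left_inv_eq_right_inv (normalCount_mul_zeta d) IncidenceAlgebra.zeta_mul_mu
  exact seriesOf_eq_countSeries fun u w => hmu ▸ rfl

/-! ### Embeddings as markings -/

section markAt

variable {α : Type*} {k : ℕ} {w : List α}

/-- The marking of `w` at the positions `i 0 < i 1 < ⋯`. -/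
def markAt (w : List α) (i : Fin k ↪o Fin w.length) : List (α × Bool) :=
  List.ofFn fun q => (w.get q, decide (q ∈ Set.range i))

theorem length_markAt (i : Fin k ↪o Fin w.length) : (markAt w i).length = w.length :=
  List.length_ofFn

theorem getElem_markAt (i : Fin k ↪o Fin w.length) (q : Fin w.length)
    (hq : (q : ℕ) < (markAt w i).length) :
    (markAt w i)[(q : ℕ)] = (w.get q, decide (q ∈ Set.range i)) :=
  List.getElem_ofFn hq

theorem underlying_markAt (i : Fin k ↪o Fin w.length) : underlying (markAt w i) = w := by
  rw [underlying, markAt, List.map_ofFn]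
  exact List.ofFn_get w

theorem mem_drop_finRange {n m : ℕ} {q : Fin n} : q ∈ (List.finRange n).drop m ↔ m ≤ q := by
  simp only [List.mem_drop_iff_getElem, List.getElem_finRange, List.length_finRange]
  constructor
  · rintro ⟨l, hl, rfl⟩
    exact Nat.le_add_right m l
  · exact fun h => ⟨q - m, by omega, Fin.ext (by simp only [Fin.val_cast]; omega)⟩

theorem selected_drop_markAt (i : Fin k ↪o Fin w.length) {q m : ℕ}
    (h : ∀ j, q ≤ (i j : ℕ) ↔ m ≤ (j : ℕ)) :
    selected ((markAt w i).drop q) = (List.ofFn (w.get ∘ i)).drop m := by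
  have hfilter : ((List.finRange w.length).drop q).filter (fun x => decide (x ∈ Set.range i)) =
      ((List.finRange k).drop m).map i := by
    refine List.SortedLT.eq_of_mem_iff ?_ ?_ fun x => ?_
    · exact ((List.sortedLT_finRange _).pairwise.drop.filter _).sortedLT
    · exact ((List.sortedLT_finRange _).pairwise.drop.map i fun _ _ h => i.strictMono h).sortedLT
    · simp only [List.mem_filter, mem_drop_finRange, decide_eq_true_eq, List.mem_map, Set.mem_range]
      constructor
      · rintro ⟨hx, j, rfl⟩
        exact ⟨j, (h j).1 hx, rfl⟩
      · rintro ⟨j, hj, rfl⟩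
        exact ⟨(h j).2 hj, j, rfl⟩
  rw [selected, markAt, List.ofFn_eq_map, List.ofFn_eq_map, ← List.map_drop, ← List.map_drop,
    List.filter_map, List.map_map, ← List.map_map (f := i), ← hfilter]
  rfl

theorem selected_markAt (i : Fin k ↪o Fin w.length) :
    selected (markAt w i) = List.ofFn (w.get ∘ i) :=
  selected_drop_markAt (q := 0) (m := 0) i fun _ => iff_of_true (Nat.zero_le _) (Nat.zero_le _)

theorem markAt_injective : Function.Injective (markAt (k := k) w) := by
  intro i i' h
  refine OrderEmbedding.range_inj.1 (Set.ext fun q => ?_)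
  exact decide_eq_decide.1 (congrArg Prod.snd (congrFun (List.ofFn_injective h) q))

theorem exists_markAt_eq (p : List (α × Bool)) :
    ∃ (k : ℕ) (i : Fin k ↪o Fin (underlying p).length), markAt (underlying p) i = p := by
  have hlen := length_underlying p
  let S : Finset (Fin (underlying p).length) := {q | (p.get (q.cast hlen)).2 = true}
  have hS : ∀ q, q ∈ Set.range (S.orderEmbOfFin rfl) ↔ (p.get (q.cast hlen)).2 = true := fun q => by
    rw [Finset.range_orderEmbOfFin, Finset.mem_coe, Finset.mem_filter_univ]
  refine ⟨S.card, S.orderEmbOfFin rfl,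
    List.ext_get ((length_markAt _).trans hlen) fun q hq hq' => ?_⟩
  refine (getElem_markAt _ ⟨q, hq'.trans_eq hlen.symm⟩ hq).trans (Prod.ext ?_ ?_)
  · exact List.getElem_map _
  · simp only [hS, Bool.decide_eq_true]
    rfl

end markAt

namespace Embedding

variable {u w : List Letter}

/-- The marking of `w` at the positions of an embedding. -/
def marking (i : Embedding u w) : List (Letter × Bool) := markAt w i.1

theorem length_marking (i : Embedding u w) : i.marking.length = w.length :=
  length_markAt i.1

theorem underlying_marking (i : Embedding u w) : underlying i.marking = w :=
  underlying_markAt i.1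

theorem ofFn_get_comp (i : Embedding u w) : List.ofFn (w.get ∘ i.1) = u :=
  (congrArg List.ofFn (funext fun j => (i.2 j).symm)).trans (List.ofFn_get u)

theorem selected_marking (i : Embedding u w) : selected i.marking = u :=
  (selected_markAt i.1).trans i.ofFn_get_comp

theorem selected_drop_marking (i : Embedding u w) (j : Fin u.length) :
    selected (i.marking.drop (i.1 j)) = u.drop j :=
  (selected_drop_markAt i.1 fun _ => i.1.le_iff_le).trans (congrArg (·.drop j) i.ofFn_get_comp)

theorem selected_take_marking (i : Embedding u w) (j : Fin u.length) :
    selected (i.marking.take (i.1 j)) = u.take j := by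
  have h := selected_append (i.marking.take (i.1 j)) (i.marking.drop (i.1 j))
  rw [List.take_append_drop, selected_marking, selected_drop_marking] at h
  exact (List.append_cancel_right ((List.take_append_drop _ _).trans h)).symm

theorem nonempty_markings_equiv (L : Language (Letter × Bool)) (u w : List Letter) :
    Nonempty (markings L u w ≃ {i : Embedding u w // i.marking ∈ L}) := by
  refine ⟨(Equiv.ofBijective (fun i : {i : Embedding u w // i.marking ∈ L} =>
    (⟨i.1.marking, i.2, i.1.selected_marking, i.1.underlying_marking⟩ : markings L u w))
    ⟨fun i i' h => ?_, ?_⟩).symm⟩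
  · exact Subtype.ext (Subtype.ext (markAt_injective (congrArg Subtype.val h)))
  · rintro ⟨p, hp, rfl, rfl⟩
    obtain ⟨k, i, hi⟩ := exists_markAt_eq p
    have hsel : selected p = List.ofFn ((underlying p).get ∘ i) := by rw [← selected_markAt, hi]
    obtain rfl : k = (selected p).length := by rw [hsel, List.length_ofFn]
    have hget : ∀ j, (selected p).get j = (underlying p).get (i j) := fun j => by
      rw [List.get_of_eq hsel, List.get_ofFn]
      rfl
    exact ⟨⟨⟨i, hget⟩, (congrArg (· ∈ L) hi).mpr hp⟩, Subtype.ext hi⟩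

end Embedding

/-! ### Normal embeddings -/

/-- The parts `r` of a marked word after which a run of `d` letters `b` may start to be marked; in
terms of the prefix `r`, this is the condition `good` of `IsNormalMarking`. -/
def GoodPrefix (r : List (Letter × Bool)) : Prop :=
  (selected r ≠ [] → r.getLast? = some (Letter.a, true)) ∧
    (selected r = [] → Letter.b ∉ underlying r)

theorem goodPrefix_concat_true (r : List (Letter × Bool)) (x : Letter) :
    GoodPrefix (r ++ [(x, true)]) ↔ x = Letter.a := by
  simp [GoodPrefix]

theorem goodPrefix_concat_false {r : List (Letter × Bool)} {x : Letter}
    (hx : r.getLast?.map Prod.fst ≠ some x) :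
    GoodPrefix (r ++ [(x, false)]) ↔ x = Letter.a ∧ GoodPrefix r := by
  have hlast : x = Letter.a → r.getLast? ≠ some (Letter.a, true) := by
    rintro rfl h
    exact hx (congrArg (Option.map Prod.fst) h)
  cases x <;> simp [GoodPrefix, hlast]

theorem isNormalMarking_iff_of_prefix (d : ℕ) (r p : List (Letter × Bool)) :
    IsNormalMarking d (r.getLast?.map Prod.fst) (GoodPrefix r) p ↔ ∀ q : Fin p.length,
      ((r ++ p.take q).getLast?.map Prod.fst = some (p.get q).1 → (p.get q).2 = true) ∧
        ((p.get q).2 = true → StartsWithRun d (selected (p.drop q)) →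
          GoodPrefix (r ++ p.take q)) := by
  induction p generalizing r with
  | nil => exact iff_of_true trivial fun q => q.elim0
  | cons e p ih =>
    have hconcat : ∀ q, r ++ e :: p.take q = (r ++ [e]) ++ p.take q := fun q =>
      List.append_cons r e _
    have hlast : (r ++ [e]).getLast?.map Prod.fst = some e.1 := by
      rw [List.getLast?_concat, Option.map_some]
    have hget : ∀ q : Fin p.length, (e :: p).get q.succ = p.get q := fun q => rfl
    refine Iff.trans ?_ Fin.forall_fin_succ.symm
    simp only [List.get_cons_zero, hget, Fin.val_zero, Fin.val_succ, List.take_zero,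
      List.take_succ_cons, List.drop_zero, List.drop_succ_cons, List.append_nil, hconcat, ← ih,
      hlast]
    obtain ⟨x, _ | _⟩ := e
    · simp only [IsNormalMarking, Bool.false_eq_true, imp_false, false_imp_iff, and_true]
      refine and_congr_right fun hx => ?_
      rw [goodPrefix_concat_false hx]
    · simp only [IsNormalMarking, selected_cons_true, goodPrefix_concat_true, true_imp_iff,
        implies_true, true_and]

theorem isNormalMarking_iff (d : ℕ) (p : List (Letter × Bool)) :
    IsNormalMarking d none True p ↔ ∀ q : Fin p.length,
      ((p.take q).getLast?.map Prod.fst = some (p.get q).1 → (p.get q).2 = true) ∧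
        ((p.get q).2 = true → StartsWithRun d (selected (p.drop q)) → GoodPrefix (p.take q)) := by
  have hgood : GoodPrefix [] ↔ True := by simp [GoodPrefix]
  rw [← hgood]
  exact isNormalMarking_iff_of_prefix d [] p

theorem getLast?_take_eq_some_iff {α : Type*} {l : List α} {q : ℕ} (hq : q ≤ l.length) {e : α} :
    (l.take q).getLast? = some e ↔ ∃ p : Fin l.length, (p : ℕ) + 1 = q ∧ l.get p = e := by
  obtain _ | q := q
  · exact iff_of_false (by simp) fun ⟨p, hp, _⟩ => Nat.succ_ne_zero _ hp
  · rw [List.take_succ_eq_append_getElem hq, List.getLast?_concat, Option.some_inj]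
    constructor
    · exact fun h => ⟨⟨q, hq⟩, rfl, h⟩
    · rintro ⟨p, hp, rfl⟩
      obtain rfl : (p : ℕ) = q := Nat.succ.inj hp
      rfl

namespace Embedding

variable {u w : List Letter} (i : Embedding u w)

theorem get_marking (q : Fin w.length) :
    i.marking.get (finCongr i.length_marking.symm q) = (w.get q, decide (q ∈ Set.range i.1)) :=
  getElem_markAt i.1 q _

theorem isNormalMarking_marking_iff (d : ℕ) :
    IsNormalMarking d none True i.marking ↔
      (∀ q : Fin w.length, (w.take q).getLast? = some (w.get q) → q ∈ Set.range i.1) ∧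
        ∀ j : Fin u.length, StartsWithRun d (u.drop j) →
          GoodPrefix (i.marking.take (i.1 j)) := by
  have hlast (q : ℕ) : (i.marking.take q).getLast?.map Prod.fst = (w.take q).getLast? := by
    rw [← List.getLast?_map, List.map_take]
    exact congrArg (fun l => (l.take q).getLast?) i.underlying_marking
  rw [isNormalMarking_iff, ← (finCongr i.length_marking.symm).forall_congr_right]
  simp only [get_marking, decide_eq_true_eq, finCongr_apply_coe, hlast, forall_and,
    Set.forall_mem_range, selected_drop_marking]

theorem goodPrefix_take_marking_iff (j : Fin u.length) :
    GoodPrefix (i.marking.take (i.1 j)) ↔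
      (0 < (j : ℕ) → ∃ p : Fin w.length,
        (p : ℕ) + 1 = i.1 j ∧ w.get p = Letter.a ∧ p ∈ Set.range i.1) ∧
      ((j : ℕ) = 0 → ∀ p < i.1 j, w.get p ≠ Letter.b) := by
  have htake : u.take j = [] ↔ (j : ℕ) = 0 := by
    rw [List.take_eq_nil_iff, or_iff_left (List.length_pos_iff.1 j.pos)]
  have hunderlying : underlying (i.marking.take (i.1 j)) = w.take (i.1 j) :=
    List.map_take.trans (congrArg (List.take _) i.underlying_marking)
  have hle : (i.1 j : ℕ) ≤ i.marking.length := (i.1 j).2.le.trans_eq i.length_marking.symm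
  rw [GoodPrefix, selected_take_marking, hunderlying, Ne, htake, Nat.pos_iff_ne_zero,
    getLast?_take_eq_some_iff hle, ← (finCongr i.length_marking.symm).exists_congr_right]
  refine and_congr (imp_congr_right fun _ => exists_congr fun p => and_congr_right fun _ => ?_)
    (imp_congr_right fun _ => ?_)
  · rw [get_marking, Prod.mk.injEq, decide_eq_true_eq]
  · simp only [List.mem_take_iff_getElem, not_exists]
    constructor
    · exact fun h p hp hb => h p (lt_min hp p.2) hb
    · exact fun h p hp hb => h ⟨p, (lt_min_iff.1 hp).2⟩ (lt_min_iff.1 hp).1 hb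

theorem isNormal_iff (d : ℕ) : i.IsNormal d ↔ IsNormalMarking d none True i.marking := by
  rw [isNormalMarking_marking_iff]
  simp only [getLast?_take_eq_some_iff (Fin.is_lt _).le, goodPrefix_take_marking_iff]
  constructor
  · intro h
    refine ⟨?_, fun j hrun => ⟨fun hj => h.inner_run hrun.1 j hj hrun.2, fun hj => ?_⟩⟩
    · rintro q ⟨p, hpq, hp⟩
      exact h.repetition p q hpq.symm hp.symm
    · rw [hj] at hrun
      exact h.initial_run hrun.1 j hj hrun.2
  · rintro ⟨hrep, hrun⟩
    refine ⟨fun p q hpq h => hrep q ⟨p, hpq.symm, h.symm⟩,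
      fun hd j hj h => (hrun j ⟨hd, h⟩).1 hj, fun hd j hj h => (hrun j ⟨hd, ?_⟩).2 hj⟩
    rwa [hj, List.drop_zero]

end Embedding

theorem nonempty_markings_equiv_normal (d : ℕ) (u w : List Letter) :
    Nonempty (markings (normalLanguage d none True) u w ≃ {i : Embedding u w // i.IsNormal d}) := by
  obtain ⟨φ⟩ := Embedding.nonempty_markings_equiv (normalLanguage d none True) u w
  exact ⟨φ.trans (Equiv.subtypeEquivRight fun i => (i.isNormal_iff d).symm)⟩

end WordPoset

open WordPoset in
theorem theorem4p3 (d : ℕ) :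
    (WordPoset.zetaSeries d).IsRational ∧ (WordPoset.muSeries d).IsRational ∧
    (∃ D : WordPoset.Automaton, D.Accepts (WordPoset.zetaSeries d) ∧
      (∀ W : D.Walk, WordPoset.InAd d (D.walkLeft W) ∧ WordPoset.InAd d (D.walkRight W) ∧
        D.walkCoeff W = 1) ∧
      ∀ u w : WordPoset.Word d, Nonempty (D.WalkOn u.letters w.letters ≃
        {i : WordPoset.Embedding u.letters w.letters // i.IsRightmost})) ∧
    (∃ D : WordPoset.Automaton, D.Accepts (WordPoset.muSeries d) ∧
      (∀ W : D.Walk, WordPoset.InAd d (D.walkLeft W) ∧ WordPoset.InAd d (D.walkRight W) ∧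
        D.walkCoeff W = (-1) ^ ((D.walkLeft W).length + (D.walkRight W).length)) ∧
      ∀ u w : WordPoset.Word d, Nonempty (D.WalkOn u.letters w.letters ≃
        {i : WordPoset.Embedding u.letters w.letters // i.IsNormal d})) := by
  rw [zetaSeries_eq, muSeries_eq]
  have hζ := isRegular_rightmostLanguage (α := Letter) none
  have hμ := isRegular_normalLanguage d none True
  refine ⟨isRational_countSeries 1 (isRegular_restrict d hζ),
    isRational_countSeries (-1) (isRegular_restrict d hμ), ?_, ?_⟩
  · obtain ⟨D, hacc, hwalk, hequiv⟩ := exists_automaton_restrict 1 d hζ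
    refine ⟨D, hacc, fun W => ?_, fun u w => ?_⟩
    · obtain ⟨hleft, hright, hcoeff⟩ := hwalk W
      exact ⟨hleft, hright, hcoeff.trans (one_pow _)⟩
    · exact (hequiv u w).map2 Equiv.trans (nonempty_markings_equiv_rightmost _ _)
  · obtain ⟨D, hacc, hwalk, hequiv⟩ := exists_automaton_restrict (-1) d hμ
    exact ⟨D, hacc, hwalk, fun u w =>
      (hequiv u w).map2 Equiv.trans (nonempty_markings_equiv_normal d _ _)⟩
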